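/- Digraphs are finite and have no loops and no multiple arcs. For a digraph $G$ let $A(G)$ be its adjacency matrix ($a_{uv}=1$ if $(u,v)$ is an arc of $G$, and $a_{uv}=0$ otherwise) and let $D(G)$ be the diagonal matrix of the outdegrees of its vertices. For $0\le\alpha<1$ put $A_\alpha(G)=\alpha D(G)+(1-\alpha)A(G)$, and let $\lambda_\alpha(G)$ be the largest modulus of the (complex) eigenvalues of $A_\alpha(G)$. The girth of $G$ is the length of a shortest directed cycle of $G$. For $2\le g\le n-1$ let $C_{n,g}$ be the digraph with vertex set $\{v_1,\dots,v_n\}$ formed by the directed cycle $v_1v_2\cdots v_gv_1$ and the directed path $v_gv_{g+1}\cdots v_nv_1$; that is, its arcs are $(v_i,v_{i+1})$ for $1\le i\le n-1$, together with $(v_g,v_1)$ and $(v_n,v_1)$. Theorem. Let $0\le\alpha<1$, let $2\le g\le n-1$, and let $G$ be a strongly connected digraph on $n$ vertices with girth $g$. Then $$\lambda_\alpha(G)\ \ge\ \lambda_\alpha(C_{n,g})\ >\ 1,$$ and $\lambda_\alpha(G)=\lambda_\alpha(C_{n,g})$ if and only if $G\cong C_{n,g}$. -/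

import Mathlib

namespace Digraph

/-- A digraph is simple if it has no loops (a relation has no multiple arcs). -/
def IsSimple {V : Type*} (G : Digraph V) : Prop :=
  ∀ v, ¬ G.Adj v v

/-- For every pair of vertices `u`, `v` there is a directed path from `u` to `v`. -/
def StronglyConnected {V : Type*} (G : Digraph V) : Prop :=
  ∀ u v, Relation.ReflTransGen G.Adj u v

/-- `G` contains a directed cycle of length `k`: distinct vertices `c 0, …, c (k - 1)` with an arc
from each one to its cyclic successor. -/
def HasDirectedCycle {V : Type*} (G : Digraph V) (k : ℕ) : Prop :=
  0 < k ∧ ∃ c : Fin k → V, Function.Injective c ∧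
    ∀ i j : Fin k, (j : ℕ) = ((i : ℕ) + 1) % k → G.Adj (c i) (c j)

/-- The length of a shortest directed cycle (`⊤` if there is no directed cycle). -/
noncomputable def girth {V : Type*} (G : Digraph V) : ℕ∞ :=
  ⨅ (k : ℕ) (_ : G.HasDirectedCycle k), (k : ℕ∞)

open Classical in
/-- The outdegree of a vertex. -/
noncomputable def outDegree {V : Type*} [Fintype V] (G : Digraph V) (v : V) : ℕ :=
  (Finset.univ.filter fun w => G.Adj v w).card

open Classical in
/-- The adjacency matrix `A(G)`. -/
noncomputable def adjacencyMatrix {V : Type*} (G : Digraph V) : Matrix V V ℝ :=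
  Matrix.of fun v w => if G.Adj v w then 1 else 0

open Classical in
/-- The diagonal matrix `D(G)` of the outdegrees. -/
noncomputable def outDegreeMatrix {V : Type*} [Fintype V] (G : Digraph V) : Matrix V V ℝ :=
  Matrix.diagonal fun v => (G.outDegree v : ℝ)

/-- The matrix `A_α(G) = α D(G) + (1 - α) A(G)`. -/
noncomputable def alphaMatrix {V : Type*} [Fintype V] (α : ℝ) (G : Digraph V) : Matrix V V ℝ :=
  α • G.outDegreeMatrix + (1 - α) • G.adjacencyMatrix

open Classical in
/-- The `A_α` spectral radius `λ_α(G)`: the largest modulus of the complex eigenvalues of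
`A_α(G)`. -/
noncomputable def alphaSpectralRadius {V : Type*} [Fintype V] (α : ℝ) (G : Digraph V) : ℝ :=
  (spectralRadius ℂ ((G.alphaMatrix α).map (fun x : ℝ => (x : ℂ)))).toReal

/-- The digraph `C_{n,g}`, the vertex `v_i` being represented by `i - 1 : Fin n`. Its arcs are
`(v_i, v_{i+1})` for `1 ≤ i < n`, together with `(v_g, v_1)` and `(v_n, v_1)`: the directed cycle
`v_1 v_2 … v_g v_1` and the directed path `v_g v_{g+1} … v_n v_1`. -/
def cycleWithPath (n g : ℕ) : Digraph (Fin n) where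
  Adj i j := (j : ℕ) = (i : ℕ) + 1 ∨ ((j : ℕ) = 0 ∧ ((i : ℕ) + 1 = g ∨ (i : ℕ) + 1 = n))

/-- Isomorphism of digraphs. -/
def IsIsomorphic {V W : Type*} (G : Digraph V) (H : Digraph W) : Prop :=
  Nonempty (G.Adj ≃r H.Adj)

end Digraph

/-! The proof compares `G` with `C_{n,g}` through a test vector. Rotate a cycle of length `g` so
that some arc leaves it at its last vertex `b`. Give the cycle the levels `0, …, g - 1` and every
other vertex minus its distance to the cycle, and put `x v = t ^ h v`, where `α + (1 - α) t` is the
spectral radius of `C_{n,g}`. Each vertex other than `b` has an out-neighbour at least one level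
higher; `b` has out-neighbours at level `0` and at some level `≥ g - n`. As `t > 1`, the row
inequalities `(α + (1 - α) t) x ≤ A_α x` follow, and Collatz–Wielandt gives the bound
(`StronglyConnected.le_alphaSpectralRadius`). If the radii agree, irreducibility makes `x` an
eigenvector (`lt_spectralRadius_of_le_mulVec_of_ne`). Then no row has a spare arc and the arc
leaving the cycle ends at level `g - n`, so all levels are distinct and they determine `G`. -/

namespace Matrix

/-! ### Collatz–Wielandt bounds for nonnegative matrices. -/

section SpectralRadius

variable {V : Type*} [Fintype V]

theorem map_ofReal_mulVec (M : Matrix V V ℝ) (x : V → ℝ) :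
    M.map (fun r : ℝ => (r : ℂ)) *ᵥ (fun v => (x v : ℂ)) = fun v => ((M *ᵥ x) v : ℂ) := by
  ext v
  simp [mulVec, dotProduct]

theorem mulVec_mono_of_nonneg {M : Matrix V V ℝ} (hM : ∀ u v, 0 ≤ M u v) {x y : V → ℝ}
    (h : x ≤ y) : M *ᵥ x ≤ M *ᵥ y := fun v =>
  Finset.sum_le_sum fun w _ => mul_le_mul_of_nonneg_left (h w) (hM v w)

variable [DecidableEq V]

theorem map_ofReal_pow (M : Matrix V V ℝ) (k : ℕ) :
    M.map (fun r : ℝ => (r : ℂ)) ^ k = (M ^ k).map (fun r : ℝ => (r : ℂ)) :=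
  (map_pow (Complex.ofRealHom.mapMatrix : Matrix V V ℝ →+* Matrix V V ℂ) M k).symm

/-- A positive vector `x` with `M x ≤ r x` bounds the modulus of every eigenvalue by `r`. -/
theorem spectralRadius_le_of_mulVec_le {M : Matrix V V ℝ} (hM : ∀ u v, 0 ≤ M u v) {x : V → ℝ}
    (hx : ∀ v, 0 < x v) {r : ℝ} (h : M *ᵥ x ≤ r • x) :
    spectralRadius ℂ (M.map (fun r : ℝ => (r : ℂ))) ≤ ENNReal.ofReal r := by
  refine iSup₂_le fun μ hμ => ?_
  rw [← Matrix.spectrum_toLin', ← Module.End.hasEigenvalue_iff_mem_spectrum] at hμ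
  obtain ⟨z, hz⟩ := hμ.exists_hasEigenvector
  have hz0 := hz.2
  have hzμ : M.map (fun r : ℝ => (r : ℂ)) *ᵥ z = μ • z := by
    simpa using hz.apply_eq_smul
  obtain ⟨v₀, hv₀⟩ := Function.ne_iff.mp hz0
  -- At this `v` the smallest multiple of `x` that dominates `|z|` touches it; row `v` of the
  -- eigenvalue equation then bounds `‖μ‖`.
  obtain ⟨v, -, hv⟩ := Finset.exists_max_image Finset.univ (fun v => ‖z v‖ / x v) ⟨v₀, by simp⟩
  have hle : ∀ w, ‖z w‖ ≤ ‖z v‖ / x v * x w := fun w => by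
    rw [← div_le_iff₀ (hx w)]; exact hv w (by simp)
  have hzv : 0 < ‖z v‖ / x v :=
    lt_of_lt_of_le (div_pos (norm_pos_iff.mpr hv₀) (hx v₀)) (hv v₀ (by simp))
  have key : ‖μ‖ * ‖z v‖ ≤ r * ‖z v‖ := by
    calc ‖μ‖ * ‖z v‖ = ‖(M.map (fun r : ℝ => (r : ℂ)) *ᵥ z) v‖ := by simp [hzμ]
      _ ≤ ∑ w, M v w * ‖z w‖ := by
        refine (norm_sum_le _ _).trans (Finset.sum_le_sum fun w _ => ?_)
        simp [abs_of_nonneg (hM v w)]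
      _ ≤ ∑ w, M v w * (‖z v‖ / x v * x w) :=
        Finset.sum_le_sum fun w _ => mul_le_mul_of_nonneg_left (hle w) (hM v w)
      _ = ‖z v‖ / x v * (M *ᵥ x) v := by
        simp only [mulVec, dotProduct, Finset.mul_sum]
        exact Finset.sum_congr rfl fun w _ => by ring
      _ ≤ ‖z v‖ / x v * (r * x v) := mul_le_mul_of_nonneg_left (h v) hzv.le
      _ = r * ‖z v‖ := by have := (hx v).ne'; field_simp
  have hpos : 0 < ‖z v‖ := by
    have := mul_pos hzv (hx v)
    rwa [div_mul_cancel₀ _ (hx v).ne'] at this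
  have := le_of_mul_le_mul_right key hpos
  exact (ofReal_norm μ).symm.trans_le (ENNReal.ofReal_le_ofReal this)

/-- `ENNReal.toReal` sends `⊤` to `0`, so finiteness is needed to carry lower bounds over to `ℝ`. -/
theorem spectralRadius_ne_top (M : Matrix V V ℂ) : spectralRadius ℂ M ≠ ⊤ := by
  let _ : NormedRing (Matrix V V ℂ) := Matrix.linftyOpNormedRing
  let _ : NormedAlgebra ℂ (Matrix V V ℂ) := Matrix.linftyOpNormedAlgebra
  have : CompleteSpace (Matrix V V ℂ) := FiniteDimensional.complete ℂ _
  rcases isEmpty_or_nonempty V with hV | hV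
  · have : Subsingleton (Matrix V V ℂ) := inferInstance
    simp
  · exact ((spectrum.spectralRadius_le_nnnorm M).trans_lt ENNReal.coe_lt_top).ne

theorem pow_smul_le_pow_mulVec {M : Matrix V V ℝ} (hM : ∀ u v, 0 ≤ M u v) {x : V → ℝ}
    {r : ℝ} (hr : 0 ≤ r) (h : r • x ≤ M *ᵥ x) (k : ℕ) : r ^ k • x ≤ (M ^ k) *ᵥ x := by
  induction k with
  | zero => simp
  | succ k ih =>
    calc r ^ (k + 1) • x = r ^ k • (r • x) := by rw [smul_smul, pow_succ]
      _ ≤ r ^ k • (M *ᵥ x) := smul_le_smul_of_nonneg_left h (pow_nonneg hr k)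
      _ = M *ᵥ (r ^ k • x) := by rw [mulVec_smul]
      _ ≤ M *ᵥ ((M ^ k) *ᵥ x) := mulVec_mono_of_nonneg hM ih
      _ = (M ^ (k + 1)) *ᵥ x := by rw [mulVec_mulVec, pow_succ']

/-- A positive vector `x` with `r x ≤ M x` bounds the spectral radius from below by `r`. -/
theorem le_spectralRadius_of_le_mulVec [Nonempty V] {M : Matrix V V ℝ} (hM : ∀ u v, 0 ≤ M u v)
    {x : V → ℝ} (hx : ∀ v, 0 < x v) {r : ℝ} (hr : 0 ≤ r) (h : r • x ≤ M *ᵥ x) :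
    ENNReal.ofReal r ≤ spectralRadius ℂ (M.map (fun r : ℝ => (r : ℂ))) := by
  let _ : NormedRing (Matrix V V ℂ) := Matrix.linftyOpNormedRing
  let _ : NormedAlgebra ℂ (Matrix V V ℂ) := Matrix.linftyOpNormedAlgebra
  have : CompleteSpace (Matrix V V ℂ) := FiniteDimensional.complete ℂ _
  -- By Gelfand's formula it suffices that `r ^ k ≤ ‖M ^ k‖`, which is read off at a largest entry
  -- of `x`.
  refine ge_of_tendsto (spectrum.pow_nnnorm_pow_one_div_tendsto_nhds_spectralRadius
    (M.map (fun r : ℝ => (r : ℂ)))) ?_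
  filter_upwards [Filter.eventually_gt_atTop 0] with k hk
  have hnorm : r ^ k ≤ ‖M.map (fun r : ℝ => (r : ℂ)) ^ k‖ := by
    obtain ⟨v, -, hv⟩ := Finset.exists_max_image Finset.univ x Finset.univ_nonempty
    have hxn : ‖fun w => (x w : ℂ)‖ ≤ x v :=
      (pi_norm_le_iff_of_nonneg (hx v).le).mpr fun w => by
        simpa [abs_of_pos (hx w)] using hv w (by simp)
    have h1 : r ^ k * x v ≤ ((M ^ k) *ᵥ x) v := pow_smul_le_pow_mulVec hM hr h k v
    have h2 : ((M ^ k) *ᵥ x) v ≤ ‖M.map (fun r : ℝ => (r : ℂ)) ^ k‖ * x v := by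
      calc ((M ^ k) *ᵥ x) v ≤ ‖(((M ^ k) *ᵥ x) v : ℂ)‖ := by
            rw [Complex.norm_real]; exact le_abs_self _
        _ = ‖(M.map (fun r : ℝ => (r : ℂ)) ^ k *ᵥ fun w => (x w : ℂ)) v‖ := by
            rw [map_ofReal_pow, map_ofReal_mulVec]
        _ ≤ ‖M.map (fun r : ℝ => (r : ℂ)) ^ k *ᵥ fun w => (x w : ℂ)‖ := norm_le_pi_norm _ v
        _ ≤ ‖M.map (fun r : ℝ => (r : ℂ)) ^ k‖ * ‖fun w => (x w : ℂ)‖ :=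
            linfty_opNorm_mulVec _ _
        _ ≤ _ := mul_le_mul_of_nonneg_left hxn (norm_nonneg _)
    exact le_of_mul_le_mul_right (h1.trans h2) (hx v)
  have hk' : (0 : ℝ) < k := by exact_mod_cast hk
  rw [one_div, ENNReal.le_rpow_inv_iff hk', ENNReal.rpow_natCast, ← ENNReal.ofReal_pow hr]
  refine ENNReal.ofReal_le_of_le_toReal ?_
  simpa using hnorm

/-- If `M` is irreducible, the lower bound for the spectral radius is strict unless the test vector
is an eigenvector. -/
theorem lt_spectralRadius_of_le_mulVec_of_ne [Nonempty V] {M : Matrix V V ℝ}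
    (hM : ∀ u v, 0 ≤ M u v) (hirr : ∀ u v, ∃ k : ℕ, 0 < (M ^ k) u v)
    {x : V → ℝ} (hx : ∀ v, 0 < x v) {r : ℝ} (hr : 0 ≤ r) (h : r • x ≤ M *ᵥ x)
    (hne : M *ᵥ x ≠ r • x) :
    ENNReal.ofReal r < spectralRadius ℂ (M.map (fun r : ℝ => (r : ℂ))) := by
  obtain ⟨v₀, hv₀⟩ := Function.ne_iff.mp hne
  have hv₀ : r * x v₀ < (M *ᵥ x) v₀ := lt_of_le_of_ne (h v₀) (Ne.symm hv₀)
  have hpow : ∀ k u v, 0 ≤ (M ^ k) u v := by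
    intro k
    induction k with
    | zero => intro u v; simp only [pow_zero, one_apply]; split_ifs <;> norm_num
    | succ k ih =>
      intro u v
      rw [pow_succ, mul_apply]
      exact Finset.sum_nonneg fun w _ => mul_nonneg (ih u w) (hM w v)
  choose k hk using fun v => hirr v v₀
  -- `B` commutes with `M` and its column `v₀` is positive, so passing from `x` to `B x` spreads the
  -- strict inequality in row `v₀` to every row. The least ratio `s` then exceeds `r`.
  set B : Matrix V V ℝ := 1 + ∑ u, M ^ k u with hB
  have hcomm : M * B = B * M := by
    simp only [hB, mul_add, add_mul, mul_one, one_mul, Finset.mul_sum, Finset.sum_mul,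
      ← pow_succ, ← pow_succ']
  have hBge : ∀ v w, (M ^ k v) v w ≤ B v w := by
    intro v w
    have h1 : (M ^ k v) v w ≤ ∑ u, (M ^ k u) v w :=
      Finset.single_le_sum (f := fun u => (M ^ k u) v w) (fun u _ => hpow _ _ _)
        (Finset.mem_univ v)
    have h2 : 0 ≤ (1 : Matrix V V ℝ) v w := by rw [one_apply]; split_ifs <;> norm_num
    simp only [hB, add_apply, sum_apply]
    linarith
  have hB0 : ∀ v w, 0 ≤ B v w := fun v w => (hpow _ _ _).trans (hBge v w)
  have hBdiag : ∀ v, 1 ≤ B v v := fun v => by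
    have : 0 ≤ ∑ u, (M ^ k u) v v := Finset.sum_nonneg fun u _ => hpow _ _ _
    simp only [hB, add_apply, sum_apply, one_apply_eq]
    linarith
  have hy : ∀ v, 0 < (B *ᵥ x) v := fun v =>
    Finset.sum_pos' (fun w _ => mul_nonneg (hB0 v w) (hx w).le)
      ⟨v, Finset.mem_univ v, mul_pos (by linarith [hBdiag v]) (hx v)⟩
  have hlt : ∀ v, r * (B *ᵥ x) v < (M *ᵥ (B *ᵥ x)) v := by
    intro v
    have e1 : r * (B *ᵥ x) v = (B *ᵥ (r • x)) v := by rw [mulVec_smul]; rfl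
    rw [e1, mulVec_mulVec, hcomm, ← mulVec_mulVec]
    refine Finset.sum_lt_sum (fun w _ => mul_le_mul_of_nonneg_left (h w) (hB0 v w))
      ⟨v₀, Finset.mem_univ _, mul_lt_mul_of_pos_left hv₀ ((hk v).trans_le (hBge v v₀))⟩
  obtain ⟨m, -, hm⟩ := Finset.exists_min_image Finset.univ
    (fun v => (M *ᵥ (B *ᵥ x)) v / (B *ᵥ x) v) Finset.univ_nonempty
  set s := (M *ᵥ (B *ᵥ x)) m / (B *ᵥ x) m with hs
  have hrs : r < s := by rw [hs, lt_div_iff₀ (hy m)]; exact hlt m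
  have hle : s • (B *ᵥ x) ≤ M *ᵥ (B *ᵥ x) := fun v => by
    have := hm v (Finset.mem_univ v)
    rwa [le_div_iff₀ (hy v)] at this
  refine lt_of_lt_of_le ?_ (le_spectralRadius_of_le_mulVec hM hy (hr.trans hrs.le) hle)
  exact (ENNReal.ofReal_lt_ofReal_iff (hr.trans_lt hrs)).mpr hrs

end SpectralRadius

end Matrix

namespace Digraph

/-! ### The matrix `A_α` of a digraph. -/

section AlphaMatrix

variable {V : Type*} [Fintype V]

open Classical in
-- The degree term is distributed over the arcs, one copy of `α * x v` each. For positive `x` every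
-- arc then contributes a positive amount, so arcs can be discarded one by one.
theorem alphaMatrix_mulVec (G : Digraph V) (α : ℝ) (x : V → ℝ) (v : V) :
    (G.alphaMatrix α).mulVec x v =
      ∑ w ∈ Finset.univ.filter (fun w => G.Adj v w), (α * x v + (1 - α) * x w) := by
  rw [Finset.sum_add_distrib, Finset.sum_const, ← Finset.mul_sum, alphaMatrix, Matrix.add_mulVec,
    Matrix.smul_mulVec, Matrix.smul_mulVec, outDegreeMatrix]
  simp only [Pi.add_apply, Pi.smul_apply, Matrix.mulVec_diagonal, smul_eq_mul, nsmul_eq_mul]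
  congr 1
  · rw [outDegree]; ring
  · simp [Matrix.mulVec, dotProduct, adjacencyMatrix, Finset.sum_filter]

theorem alphaMatrix_nonneg (G : Digraph V) {α : ℝ} (hα0 : 0 ≤ α) (hα1 : α < 1) (u v : V) :
    0 ≤ G.alphaMatrix α u v := by
  classical
  simp only [alphaMatrix, outDegreeMatrix, adjacencyMatrix, Matrix.add_apply, Matrix.smul_apply,
    Matrix.diagonal_apply, Matrix.of_apply, smul_eq_mul]
  refine add_nonneg (mul_nonneg hα0 ?_) (mul_nonneg (by linarith) ?_) <;> split_ifs <;> simp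

theorem alphaMatrix_pos_of_adj (G : Digraph V) {α : ℝ} (hα0 : 0 ≤ α) (hα1 : α < 1) {u v : V}
    (h : G.Adj u v) : 0 < G.alphaMatrix α u v := by
  classical
  simp only [alphaMatrix, outDegreeMatrix, adjacencyMatrix, Matrix.add_apply, Matrix.smul_apply,
    Matrix.diagonal_apply, Matrix.of_apply, smul_eq_mul, if_pos h]
  refine add_pos_of_nonneg_of_pos (mul_nonneg hα0 ?_) (by linarith)
  split_ifs <;> simp

theorem StronglyConnected.exists_alphaMatrix_pow_pos [DecidableEq V] {G : Digraph V}
    (hG : G.StronglyConnected) {α : ℝ} (hα0 : 0 ≤ α) (hα1 : α < 1) (u v : V) :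
    ∃ k : ℕ, 0 < (G.alphaMatrix α ^ k) u v := by
  have h := hG u v
  induction h using Relation.ReflTransGen.head_induction_on with
  | refl => exact ⟨0, by simp⟩
  | @head a b hab hbv ih =>
    obtain ⟨k, hk⟩ := ih
    have hpow : ∀ k u v, 0 ≤ (G.alphaMatrix α ^ k) u v := by
      intro k
      induction k with
      | zero => intro u v; simp only [pow_zero, Matrix.one_apply]; split_ifs <;> norm_num
      | succ k ih =>
        intro u v
        rw [pow_succ, Matrix.mul_apply]
        exact Finset.sum_nonneg fun w _ =>
          mul_nonneg (ih u w) (G.alphaMatrix_nonneg hα0 hα1 w v)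
    refine ⟨k + 1, ?_⟩
    rw [pow_succ', Matrix.mul_apply]
    exact Finset.sum_pos' (fun w _ => mul_nonneg (G.alphaMatrix_nonneg hα0 hα1 a w) (hpow k w v))
      ⟨b, Finset.mem_univ b, mul_pos (G.alphaMatrix_pos_of_adj hα0 hα1 hab) hk⟩

theorem alphaSpectralRadius_eq_of_mulVec_eq [Nonempty V] (G : Digraph V) {α : ℝ} (hα0 : 0 ≤ α)
    (hα1 : α < 1) {x : V → ℝ} (hx : ∀ v, 0 < x v) {r : ℝ} (hr : 0 ≤ r)
    (h : (G.alphaMatrix α).mulVec x = r • x) : G.alphaSpectralRadius α = r := by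
  classical
  have hM := G.alphaMatrix_nonneg hα0 hα1
  have h1 := Matrix.spectralRadius_le_of_mulVec_le hM hx h.le
  have h2 := Matrix.le_spectralRadius_of_le_mulVec hM hx hr h.ge
  have h3 := (le_antisymm h1 h2)
  have h4 : G.alphaSpectralRadius α = (ENNReal.ofReal r).toReal := by
    rw [← h3, alphaSpectralRadius]
  rw [h4, ENNReal.toReal_ofReal hr]

theorem le_alphaSpectralRadius_of_le_mulVec [Nonempty V] (G : Digraph V) {α : ℝ} (hα0 : 0 ≤ α)
    (hα1 : α < 1) {x : V → ℝ} (hx : ∀ v, 0 < x v) {r : ℝ} (hr : 0 ≤ r)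
    (h : r • x ≤ (G.alphaMatrix α).mulVec x) : r ≤ G.alphaSpectralRadius α := by
  classical
  have h2 := Matrix.le_spectralRadius_of_le_mulVec (G.alphaMatrix_nonneg hα0 hα1) hx hr h
  rw [ENNReal.ofReal_le_iff_le_toReal (Matrix.spectralRadius_ne_top _)] at h2
  rw [alphaSpectralRadius]
  convert h2

theorem StronglyConnected.mulVec_eq_of_alphaSpectralRadius_eq [Nonempty V] {G : Digraph V}
    (hG : G.StronglyConnected) {α : ℝ} (hα0 : 0 ≤ α)
    (hα1 : α < 1) {x : V → ℝ} (hx : ∀ v, 0 < x v) {r : ℝ} (hr : 0 ≤ r)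
    (h : r • x ≤ (G.alphaMatrix α).mulVec x) (hrad : G.alphaSpectralRadius α = r) :
    (G.alphaMatrix α).mulVec x = r • x := by
  classical
  by_contra hne
  have h2 := Matrix.lt_spectralRadius_of_le_mulVec_of_ne (G.alphaMatrix_nonneg hα0 hα1)
    (hG.exists_alphaMatrix_pow_pos hα0 hα1) hx hr h hne
  rw [ENNReal.ofReal_lt_iff_lt_toReal hr (Matrix.spectralRadius_ne_top _)] at h2
  refine absurd hrad (ne_of_gt ?_)
  rw [alphaSpectralRadius]
  convert h2

end AlphaMatrix

/-! ### Levels relative to a cycle, and recognition of `C_{n,g}`. -/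

section Levels

variable {V : Type*}

theorem hasDirectedCycle_of_girth_eq {G : Digraph V} {g : ℕ} (h : G.girth = (g : ℕ∞)) :
    G.HasDirectedCycle g := by
  by_contra hg
  have hlt : ∀ k : ℕ, G.HasDirectedCycle k → g + 1 ≤ k := by
    intro k hk
    have h1 : (g : ℕ∞) ≤ k := by rw [← h]; exact iInf₂_le k hk
    have h2 : g ≤ k := by exact_mod_cast h1
    rcases h2.eq_or_lt with rfl | h3
    · exact absurd hk hg
    · exact h3
  have : ((g + 1 : ℕ) : ℕ∞) ≤ G.girth := le_iInf₂ fun k hk => by exact_mod_cast hlt k hk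
  rw [h] at this
  have : g + 1 ≤ g := by exact_mod_cast this
  omega

/-- A walk of length `k` leads from the given vertex to the set `S`. -/
def Reaches (G : Digraph V) (S : Set V) : ℕ → V → Prop
  | 0, v => v ∈ S
  | k + 1, v => ∃ w, G.Adj v w ∧ G.Reaches S k w

/-- Distances to a set `S` of vertices that can be reached from everywhere. -/
theorem exists_distance_to {G : Digraph V} (S : Set V)
    (hS : ∀ v, ∃ s ∈ S, Relation.ReflTransGen G.Adj v s) :
    ∃ δ : V → ℕ, (∀ v, δ v = 0 ↔ v ∈ S) ∧
      ∀ v, v ∉ S → ∃ w, G.Adj v w ∧ δ v = δ w + 1 := by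
  classical
  have hR : ∀ v, ∃ k, G.Reaches S k v := by
    intro v
    obtain ⟨s, hs, hvs⟩ := hS v
    induction hvs using Relation.ReflTransGen.head_induction_on with
    | refl => exact ⟨0, hs⟩
    | @head a b hab _ ih =>
      obtain ⟨k, hk⟩ := ih
      exact ⟨k + 1, b, hab, hk⟩
  refine ⟨fun v => Nat.find (hR v), fun v => (Nat.find_eq_zero (hR v)), fun v hv => ?_⟩
  have h0 : Nat.find (hR v) ≠ 0 := fun h => hv ((Nat.find_eq_zero _).mp h)
  obtain ⟨k, hk⟩ := Nat.exists_eq_succ_of_ne_zero h0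
  have hspec := Nat.find_spec (hR v)
  rw [hk] at hspec
  obtain ⟨w, hvw, hw⟩ := hspec
  refine ⟨w, hvw, ?_⟩
  have h1 : Nat.find (hR w) ≤ k := Nat.find_min' _ hw
  have h2 : Nat.find (hR v) ≤ Nat.find (hR w) + 1 :=
    Nat.find_min' _ ⟨w, hvw, Nat.find_spec (hR w)⟩
  show Nat.find (hR v) = Nat.find (hR w) + 1
  omega

/-- A non-spanning directed cycle of a strongly connected digraph, numbered so that an arc leaves
the cycle at its last vertex. -/
theorem StronglyConnected.exists_cycle_with_exit [Fintype V] {G : Digraph V}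
    (hG : G.StronglyConnected) {g : ℕ} (hg : G.HasDirectedCycle g) (hcard : g < Fintype.card V) :
    ∃ c : ℕ → V, (∀ i < g, ∀ j < g, c i = c j → i = j) ∧
      (∀ i, i + 1 < g → G.Adj (c i) (c (i + 1))) ∧ G.Adj (c (g - 1)) (c 0) ∧
      ∃ u, (∀ i < g, u ≠ c i) ∧ G.Adj (c (g - 1)) u := by
  classical
  obtain ⟨hg0, c, hinj, hadj⟩ := hg
  obtain ⟨v, hv⟩ : ∃ v, v ∉ Set.range c := by
    by_contra! hall
    have := Fintype.card_le_of_surjective c hall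
    simp at this
    omega
  -- If no arc left the cycle, nothing outside it could be reached.
  obtain ⟨k, u, hu, hku⟩ : ∃ k u, u ∉ Set.range c ∧ G.Adj (c k) u := by
    by_contra! hall
    refine hv ?_
    have hpath := hG (c ⟨0, hg0⟩) v
    clear hv
    induction hpath with
    | refl => exact ⟨_, rfl⟩
    | tail _ hab ih =>
      obtain ⟨i, rfl⟩ := ih
      by_contra hb
      exact hall i _ hb hab
  have hmod : ∀ i, (i + (k + 1)) % g < g := fun i => Nat.mod_lt _ hg0
  -- The shift by `k + 1` moves the exit vertex `c k` to index `g - 1`.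
  refine ⟨fun i => c ⟨(i + (k + 1)) % g, hmod i⟩, ?_, ?_, ?_, u, ?_, ?_⟩
  · intro i hi j hj hij
    have h1 : (i + (k + 1)) % g = (j + (k + 1)) % g := congrArg Fin.val (hinj hij)
    have h2 : i ≡ j [MOD g] := Nat.ModEq.add_right_cancel' (k + 1) h1
    exact Nat.ModEq.eq_of_lt_of_lt h2 hi hj
  · intro i _
    apply hadj
    simp only [Nat.mod_add_mod]
    congr 1
    ring
  · apply hadj
    simp only [Nat.mod_add_mod]
    rw [show g - 1 + (k + 1) + 1 = 0 + (k + 1) + g by omega, Nat.add_mod_right]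
  · rintro i - rfl
    exact hu ⟨_, rfl⟩
  · convert hku
    rw [show g - 1 + ((k : ℕ) + 1) = k + g by omega, Nat.add_mod_right, Nat.mod_eq_of_lt k.2]

/-- The level function: `i` at the `i`-th vertex of a cycle of length `g`, minus the distance to the
cycle at the other vertices. -/
theorem StronglyConnected.exists_level [Fintype V] {G : Digraph V}
    (hG : G.StronglyConnected) {g : ℕ} (hg2 : 2 ≤ g) (hg : G.HasDirectedCycle g)
    (hcard : g < Fintype.card V) :
    ∃ (h : V → ℤ) (b a u : V), h b = g - 1 ∧ h a = 0 ∧ h u < 0 ∧ G.Adj b a ∧ G.Adj b u ∧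
      (∀ v, v ≠ b → ∃ w, G.Adj v w ∧ h v + 1 ≤ h w) ∧
      (∀ v, (g : ℤ) - Fintype.card V ≤ h v ∧ h v ≤ g - 1) ∧
      (h u = (g : ℤ) - Fintype.card V → Function.Injective h) := by
  classical
  obtain ⟨c, hinj, hadj, hlast, u, hu, hbu⟩ := hG.exists_cycle_with_exit hg hcard
  let S : Set V := {v | ∃ i < g, c i = v}
  obtain ⟨δ, hδ0, hδ⟩ := G.exists_distance_to S
    (fun v => ⟨c 0, ⟨0, by omega, rfl⟩, hG v (c 0)⟩)
  let h : V → ℤ := fun v => if hv : v ∈ S then (hv.choose : ℤ) else -(δ v : ℤ)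
  have hc : ∀ i < g, h (c i) = i := by
    intro i hi
    have hv : c i ∈ S := ⟨i, hi, rfl⟩
    have : hv.choose = i := hinj _ hv.choose_spec.1 _ hi hv.choose_spec.2
    simp only [h, dif_pos hv, this]
  have hoff : ∀ v, v ∉ S → h v = -(δ v : ℤ) := fun v hv => by simp only [h, dif_neg hv]
  have hS : ∀ v ∈ S, 0 ≤ h v ∧ h v ≤ g - 1 := by
    rintro _ ⟨i, hi, rfl⟩
    rw [hc i hi]; omega
  have hneg : ∀ v, v ∉ S → h v < 0 := fun v hv => by
    have := mt (hδ0 v).mp hv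
    rw [hoff v hv]; omega
  have huS : u ∉ S := by
    rintro ⟨i, hi, rfl⟩
    exact hu i hi rfl
  -- The rise is exactly one until the cycle is entered; the entry point may have any level from `0`
  -- to `g - 1`.
  have hstep : ∀ v, v ∉ S → ∃ w, G.Adj v w ∧ h v + 1 ≤ h w ∧ (h v + 1 < 0 → h w = h v + 1) := by
    intro v hv
    obtain ⟨w, hvw, hδw⟩ := hδ v hv
    refine ⟨w, hvw, ?_⟩
    rw [hoff v hv]
    by_cases hw : w ∈ S
    · have h1 := (hδ0 w).mpr hw
      have h2 := hS w hw
      omega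
    · rw [hoff w hw]
      omega
  -- No level between `h v` and `g - 1` is skipped: a shortest path to the cycle meets the negative
  -- ones, the cycle the rest. Counting gives `h v ≥ g - n`, and if `h u = g - n` then `n` levels
  -- are taken by `n` vertices, hence injectivity.
  have himage : ∀ v, Finset.Icc (h v) (g - 1) ⊆ Finset.univ.image h := by
    have key : ∀ k : ℕ, ∀ v, h v = -(k : ℤ) → Finset.Icc (h v) (g - 1) ⊆ Finset.univ.image h := by
      intro k
      induction k with
      | zero =>
        intro v hv z hz
        rw [Finset.mem_Icc, hv] at hz
        refine Finset.mem_image.mpr ⟨c z.toNat, Finset.mem_univ _, ?_⟩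
        rw [hc _ (by omega)]; omega
      | succ k ih =>
        intro v hv z hz
        rw [Finset.mem_Icc] at hz
        rcases hz.1.eq_or_lt with hz1 | hz1
        · exact Finset.mem_image.mpr ⟨v, Finset.mem_univ _, hz1⟩
        · rcases Nat.eq_zero_or_pos k with rfl | hk
          · exact ih (c 0) (by rw [hc 0 (by omega)]; simp)
              (by rw [hc 0 (by omega), Finset.mem_Icc]; push_cast at *; omega)
          · have hv' : v ∉ S := fun hv' => by have := hS v hv'; push_cast at hv; omega
            obtain ⟨w, -, -, hw⟩ := hstep v hv'
            have hw := hw (by push_cast at hv; omega)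
            refine ih w (by push_cast at hv; omega) ?_
            rw [Finset.mem_Icc]; omega
    intro v
    by_cases hv : v ∈ S
    · refine Finset.Subset.trans (Finset.Icc_subset_Icc_left ?_)
        (key 0 (c 0) (by rw [hc 0 (by omega)]; simp))
      rw [hc 0 (by omega)]
      exact (hS v hv).1
    · exact key (δ v) v (hoff v hv)
  have hlow : ∀ v, (g : ℤ) - Fintype.card V ≤ h v := by
    intro v
    have h1 := (Finset.card_le_card (himage v)).trans Finset.card_image_le
    rw [Int.card_Icc, Finset.card_univ] at h1
    omega
  refine ⟨h, c (g - 1), c 0, u, ?_, ?_, hneg u huS, hlast, hbu, ?_, ?_, ?_⟩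
  · rw [hc _ (by omega)]; omega
  · rw [hc _ (by omega)]; simp
  · intro v hvb
    by_cases hv : v ∈ S
    · obtain ⟨i, hi, rfl⟩ := hv
      have hi' : i + 1 < g := by
        by_contra hcon
        exact hvb (by congr 1; omega)
      refine ⟨c (i + 1), hadj i hi', ?_⟩
      rw [hc _ hi, hc _ hi']; push_cast; rfl
    · obtain ⟨w, hw1, hw2, -⟩ := hstep v hv
      exact ⟨w, hw1, hw2⟩
  · refine fun v => ⟨hlow v, ?_⟩
    by_cases hv : v ∈ S
    · exact (hS v hv).2
    · have := hneg v hv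
      omega
  · intro hu'
    have h1 := Finset.card_le_card (himage u)
    rw [Int.card_Icc, hu'] at h1
    have h2 : (Finset.univ.image h).card = (Finset.univ : Finset V).card := by
      refine le_antisymm Finset.card_image_le ?_
      rw [Finset.card_univ]
      omega
    intro v w hvw
    exact Finset.card_image_iff.mp h2 (Finset.mem_coe.mpr (Finset.mem_univ v))
      (Finset.mem_coe.mpr (Finset.mem_univ w)) hvw

/-- A numbering of the vertices of `G` by the integers from `g - n` to `g - 1` that exhibits `G` as
a copy of `cycleWithPath n g`: the integers `≥ 0` number the cycle, the others the path. -/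
structure IsCycleWithPathLevel (G : Digraph V) (n g : ℕ) (h : V → ℤ) : Prop where
  injective : Function.Injective h
  mem_range : ∀ v, (g : ℤ) - n ≤ h v ∧ h v ≤ g - 1
  adj_iff : ∀ v w, G.Adj v w ↔
    (h v ≠ g - 1 ∧ h w = h v + 1) ∨ (h v = g - 1 ∧ (h w = 0 ∨ h w = (g : ℤ) - n))

theorem IsCycleWithPathLevel.exists_eq [Fintype V] {G : Digraph V} {n g : ℕ} {h : V → ℤ}
    (H : G.IsCycleWithPathLevel n g h) (hcard : Fintype.card V = n) {z : ℤ}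
    (hz : (g : ℤ) - n ≤ z ∧ z ≤ g - 1) : ∃ v, h v = z := by
  classical
  have h1 : Finset.univ.image h = Finset.Icc ((g : ℤ) - n) (g - 1) := by
    refine Finset.eq_of_subset_of_card_le ?_ ?_
    · intro y hy
      obtain ⟨v, -, rfl⟩ := Finset.mem_image.mp hy
      exact Finset.mem_Icc.mpr (H.mem_range v)
    · rw [Finset.card_image_of_injective _ H.injective, Int.card_Icc, Finset.card_univ, hcard]
      omega
  have h2 : z ∈ Finset.univ.image h := by rw [h1]; exact Finset.mem_Icc.mpr hz
  obtain ⟨v, -, hv⟩ := Finset.mem_image.mp h2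
  exact ⟨v, hv⟩

/-- Subtracting `n` on the path puts `v_{g+1}, …, v_n` at levels `g - n, …, -1`, so that the path
climbs by steps of one into `v_1` at level `0`. -/
theorem isCycleWithPathLevel_cycleWithPath {n g : ℕ} (hg : 2 ≤ g) (hgn : g + 1 ≤ n) :
    (cycleWithPath n g).IsCycleWithPathLevel n g
      (fun i => if (i : ℕ) < g then (i : ℤ) else (i : ℤ) - n) where
  injective := by
    intro i j hij
    have := i.2
    have := j.2
    apply Fin.ext
    dsimp only at hij
    split_ifs at hij <;> omega
  mem_range := by
    intro i
    have := i.2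
    split_ifs <;> omega
  adj_iff := by
    intro i j
    have := i.2
    have := j.2
    simp only [cycleWithPath]
    split_ifs <;> omega

theorem IsCycleWithPathLevel.comp {W : Type*} {G : Digraph V} {K : Digraph W} {n g : ℕ} {h : W → ℤ}
    (H : K.IsCycleWithPathLevel n g h) (e : G.Adj ≃r K.Adj) :
    G.IsCycleWithPathLevel n g (h ∘ e) where
  injective := H.injective.comp e.injective
  mem_range v := H.mem_range (e v)
  adj_iff v w := by rw [← e.map_rel_iff]; exact H.adj_iff (e v) (e w)

theorem IsCycleWithPathLevel.isIsomorphic [Fintype V] {G : Digraph V} {n g : ℕ} {h : V → ℤ}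
    (H : G.IsCycleWithPathLevel n g h) (hcard : Fintype.card V = n) (hg : 2 ≤ g)
    (hgn : g + 1 ≤ n) : G.IsIsomorphic (cycleWithPath n g) := by
  classical
  let f : V → Fin n := fun v =>
    ⟨if 0 ≤ h v then (h v).toNat else (h v + n).toNat, by
      have := H.mem_range v
      split_ifs <;> omega⟩
  have hf : ∀ v, (f v : ℕ) = if 0 ≤ h v then (h v).toNat else (h v + n).toNat := fun v => rfl
  have hinj : Function.Injective f := by
    intro v w hvw
    have h0 : (f v : ℕ) = f w := congrArg Fin.val hvw
    have h1 := H.mem_range v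
    have h2 := H.mem_range w
    apply H.injective
    rw [hf, hf] at h0
    split_ifs at h0 <;> omega
  have hbij : Function.Bijective f :=
    (Fintype.bijective_iff_injective_and_card f).mpr ⟨hinj, by simp [hcard]⟩
  refine ⟨⟨Equiv.ofBijective f hbij, ?_⟩⟩
  intro v w
  have h1 := H.mem_range v
  have h2 := H.mem_range w
  rw [H.adj_iff, Equiv.ofBijective_apply, Equiv.ofBijective_apply]
  simp only [cycleWithPath, hf]
  split_ifs <;> omega

end Levels

/-! ### The test vector `t ^ h` and the case of equality. -/

section Comparison

variable {V : Type*} [Fintype V]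

/-- The defining equation of the spectral radius `α + (1 - α) t` of `cycleWithPath n g`. -/
def IsCycleWithPathRoot (α : ℝ) (n g : ℕ) (t : ℝ) : Prop :=
  (α * t ^ ((g : ℤ) - 1) + (1 - α) * t ^ (0 : ℤ)) +
      (α * t ^ ((g : ℤ) - 1) + (1 - α) * t ^ ((g : ℤ) - n)) =
    (α + (1 - α) * t) * t ^ ((g : ℤ) - 1)

/-- The equation is the row of the level `g - 1` vertex, whose out-neighbours have levels `0` and `g
- n`. The intermediate value theorem supplies a root; its uniqueness is not needed, since a positive
eigenvector already fixes the spectral radius. -/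
theorem exists_isCycleWithPathRoot {α : ℝ} (hα0 : 0 ≤ α) (hα1 : α < 1) {n g : ℕ} (hg : 2 ≤ g)
    (hgn : g + 1 ≤ n) : ∃ t, 1 < t ∧ IsCycleWithPathRoot α n g t := by
  have h1α : 0 < 1 - α := by linarith
  let F : ℝ → ℝ := fun t => (α + (1 - α) * t) * t ^ ((g : ℤ) - 1) -
    ((α * t ^ ((g : ℤ) - 1) + (1 - α) * t ^ (0 : ℤ)) +
      (α * t ^ ((g : ℤ) - 1) + (1 - α) * t ^ ((g : ℤ) - n)))
  -- With `(1 - α) T = 2` and `T ^ (g - 1) ≥ 2`, the term `(α + 2) T ^ (g - 1)` outweighs the two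
  -- arcs.
  set T : ℝ := 2 / (1 - α) with hT
  have hT2 : 2 ≤ T := by rw [hT, le_div_iff₀ h1α]; linarith
  have hTα : (1 - α) * T = 2 := by rw [hT]; field_simp
  have hcont : ContinuousOn F (Set.Icc 1 T) := by
    have hz : ∀ m : ℤ, ContinuousOn (fun t : ℝ => t ^ m) (Set.Icc 1 T) := fun m t ht =>
      (continuousAt_zpow₀ t m (Or.inl (by linarith [ht.1]))).continuousWithinAt
    have := hz ((g : ℤ) - 1)
    have := hz ((g : ℤ) - n)
    have := hz 0
    fun_prop
  have hF1 : F 1 < 0 := by simp only [F, one_zpow]; linarith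
  have hFT : 0 < F T := by
    have e1 : T ≤ T ^ ((g : ℤ) - 1) := by
      calc T = T ^ (1 : ℤ) := (zpow_one T).symm
        _ ≤ _ := zpow_le_zpow_right₀ (by linarith) (by omega)
    have e2 : T ^ ((g : ℤ) - n) ≤ 1 := zpow_le_one_of_nonpos₀ (by linarith) (by omega)
    simp only [F, hTα, zpow_zero]
    nlinarith
  obtain ⟨t, ht, hFt⟩ := intermediate_value_Ioo (by linarith) hcont ⟨hF1, hFT⟩
  exact ⟨t, ht.1, (sub_eq_zero.mp hFt).symm⟩

theorem IsCycleWithPathLevel.alphaSpectralRadius_eq {G : Digraph V} {n g : ℕ} {h : V → ℤ}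
    (H : G.IsCycleWithPathLevel n g h) (hcard : Fintype.card V = n) (hg : 2 ≤ g)
    (hgn : g + 1 ≤ n) {α : ℝ} (hα0 : 0 ≤ α) (hα1 : α < 1) {t : ℝ} (ht : 1 < t)
    (hroot : IsCycleWithPathRoot α n g t) :
    G.alphaSpectralRadius α = α + (1 - α) * t := by
  classical
  have : Nonempty V := Fintype.card_pos_iff.mp (by omega)
  have ht0 : 0 < t := by linarith
  refine G.alphaSpectralRadius_eq_of_mulVec_eq hα0 hα1 (x := fun v => t ^ h v)
    (fun v => zpow_pos ht0 _) (by nlinarith) ?_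
  ext v
  rw [alphaMatrix_mulVec]
  simp only [Pi.smul_apply, smul_eq_mul]
  have hv := H.mem_range v
  by_cases hvb : h v = g - 1
  · obtain ⟨a, ha⟩ := H.exists_eq hcard (z := 0) (by omega)
    obtain ⟨u, hu⟩ := H.exists_eq hcard (z := (g : ℤ) - n) (by omega)
    have hau : a ≠ u := by rintro rfl; omega
    have hN : Finset.univ.filter (fun w => G.Adj v w) = {a, u} := by
      ext w
      simp only [Finset.mem_filter, Finset.mem_univ, true_and, H.adj_iff, hvb, Finset.mem_insert,
        Finset.mem_singleton, ← H.injective.eq_iff, ha, hu]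
      tauto
    rw [hN, Finset.sum_pair hau, ha, hu, hvb]
    exact hroot
  · obtain ⟨w, hw⟩ := H.exists_eq hcard (z := h v + 1) (by omega)
    have hN : Finset.univ.filter (fun w => G.Adj v w) = {w} := by
      ext y
      simp only [Finset.mem_filter, Finset.mem_univ, true_and, H.adj_iff,
        Finset.mem_singleton, ← H.injective.eq_iff, hw]
      tauto
    rw [hN, Finset.sum_singleton, hw, zpow_add_one₀ ht0.ne']
    ring

theorem StronglyConnected.le_alphaSpectralRadius {G : Digraph V}
    (hG : G.StronglyConnected) {n g : ℕ} (hcard : Fintype.card V = n) (hg : 2 ≤ g)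
    (hgn : g + 1 ≤ n) (hcycle : G.HasDirectedCycle g) {α : ℝ} (hα0 : 0 ≤ α) (hα1 : α < 1) {t : ℝ}
    (ht : 1 < t) (hroot : IsCycleWithPathRoot α n g t) :
    α + (1 - α) * t ≤ G.alphaSpectralRadius α ∧
      (G.alphaSpectralRadius α = α + (1 - α) * t → ∃ h, G.IsCycleWithPathLevel n g h) := by
  classical
  have : Nonempty V := Fintype.card_pos_iff.mp (by omega)
  have ht0 : 0 < t := by linarith
  have h1α : 0 < 1 - α := by linarith
  obtain ⟨h, b, a, u, hb, ha, hu, hba, hbu, hstep, hrange, hinj⟩ :=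
    hG.exists_level hg hcycle (by omega)
  rw [hcard] at hrange hinj
  set x : V → ℝ := fun v => t ^ h v with hx
  have hx0 : ∀ v, 0 < x v := fun v => zpow_pos ht0 _
  have hr : 0 ≤ α + (1 - α) * t := by nlinarith
  have hau : a ≠ u := by rintro rfl; omega
  have hterm : ∀ v w, 0 < α * x v + (1 - α) * x w := fun v w =>
    add_pos_of_nonneg_of_pos (mul_nonneg hα0 (hx0 v).le) (mul_pos h1α (hx0 w))
  have hsingle : ∀ v w, h v + 1 ≤ h w → (α + (1 - α) * t) * x v ≤ α * x v + (1 - α) * x w := by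
    intro v w hvw
    have h1 : x v * t ≤ x w := by
      rw [hx]; dsimp only
      rw [← zpow_add_one₀ ht0.ne']
      exact zpow_le_zpow_right₀ ht.le hvw
    nlinarith
  have hbroot : (α * x b + (1 - α) * x a) + (α * x b + (1 - α) * t ^ ((g : ℤ) - n)) =
      (α + (1 - α) * t) * x b := by
    simp only [hx, hb, ha]; exact hroot
  have hxu : t ^ ((g : ℤ) - n) ≤ x u := zpow_le_zpow_right₀ ht.le (hrange u).1
  -- The root equation is this row with `u` lowered to level `g - n`, the least level possible.
  have hpair : (α + (1 - α) * t) * x b ≤ ∑ w ∈ {a, u}, (α * x b + (1 - α) * x w) := by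
    rw [Finset.sum_pair hau, ← hbroot]
    nlinarith
  have hsubpair : {a, u} ⊆ Finset.univ.filter (fun w => G.Adj b w) := by
    intro w hw
    rw [Finset.mem_insert, Finset.mem_singleton] at hw
    rcases hw with rfl | rfl <;> simpa
  have hle : (α + (1 - α) * t) • x ≤ (G.alphaMatrix α).mulVec x := by
    intro v
    rw [alphaMatrix_mulVec]
    simp only [Pi.smul_apply, smul_eq_mul]
    by_cases hvb : v = b
    · subst hvb
      exact hpair.trans (Finset.sum_le_sum_of_subset_of_nonneg hsubpair
        fun w _ _ => (hterm v w).le)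
    · obtain ⟨w, hvw, hw⟩ := hstep v hvb
      exact (hsingle v w hw).trans (Finset.single_le_sum
        (f := fun w => α * x v + (1 - α) * x w) (fun w _ => (hterm v w).le) (by simpa))
  refine ⟨G.le_alphaSpectralRadius_of_le_mulVec hα0 hα1 hx0 hr hle, fun heq => ?_⟩
  have heig := hG.mulVec_eq_of_alphaSpectralRadius_eq hα0 hα1 hx0 hr hle heq
  have hsum : ∀ v, ∑ w ∈ Finset.univ.filter (fun w => G.Adj v w), (α * x v + (1 - α) * x w) =
      (α + (1 - α) * t) * x v := fun v => by
    rw [← alphaMatrix_mulVec, heig]; rfl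
  have hxinj : ∀ {y z : ℤ}, t ^ y = t ^ z → y = z := fun {y z} hyz =>
    zpow_right_injective₀ ht0 ht.ne' hyz
  -- In a row with equality, out-neighbours that already account for the whole sum leave no room for
  -- another positive term.
  have hext : ∀ (v : V) (s : Finset V), s ⊆ Finset.univ.filter (fun w => G.Adj v w) →
      (α + (1 - α) * t) * x v ≤ ∑ w ∈ s, (α * x v + (1 - α) * x w) →
      Finset.univ.filter (fun w => G.Adj v w) = s := by
    intro v s hs hle'
    by_contra hne
    obtain ⟨y, hy, hys⟩ := Finset.exists_of_ssubset (hs.ssubset_of_ne (Ne.symm hne))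
    have := Finset.sum_lt_sum_of_subset hs hy hys (hterm v y) (fun w _ _ => (hterm v w).le)
    rw [hsum v] at this
    linarith
  have hNb := hext b _ hsubpair hpair
  have hub : h u = (g : ℤ) - n := by
    have h1 := hsum b
    rw [hNb, Finset.sum_pair hau, ← hbroot] at h1
    have h2 : (1 - α) * x u = (1 - α) * t ^ ((g : ℤ) - n) := by linarith
    exact hxinj (mul_left_cancel₀ h1α.ne' h2)
  have hinj := hinj hub
  refine ⟨h, hinj, hrange, fun v w => ?_⟩
  by_cases hvb : v = b
  · subst hvb
    have : G.Adj v w ↔ w = a ∨ w = u := by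
      have := Finset.ext_iff.mp hNb w
      simpa using this
    rw [this, ← hinj.eq_iff, ← hinj.eq_iff (b := u), ha, hub, hb]
    simp
  · obtain ⟨y, hvy, hy⟩ := hstep v hvb
    have hN := hext v {y} (by simpa) (by simpa using hsingle v y hy)
    have hy' : h y = h v + 1 := by
      have h1 := hsum v
      rw [hN, Finset.sum_singleton] at h1
      have h2 : (1 - α) * x y = (1 - α) * (x v * t) := by linarith
      have h3 := mul_left_cancel₀ h1α.ne' h2
      simp only [hx] at h3
      rw [← zpow_add_one₀ ht0.ne'] at h3
      exact hxinj h3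
    have : G.Adj v w ↔ w = y := by
      have := Finset.ext_iff.mp hN w
      simpa using this
    have hvb' : h v ≠ g - 1 := fun hcon => hvb (hinj (hcon.trans hb.symm))
    rw [this, ← hinj.eq_iff, hy']
    tauto

end Comparison

end Digraph

theorem mainTheorem3 {V : Type*} [Fintype V] (α : ℝ) (hα0 : 0 ≤ α) (hα1 : α < 1)
    (n g : ℕ) (hg : 2 ≤ g) (hgn : g ≤ n - 1)
    (G : Digraph V) (hcard : Fintype.card V = n) (hsimple : G.IsSimple)
    (hconn : G.StronglyConnected) (hgirth : G.girth = (g : ℕ∞)) :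
    (Digraph.cycleWithPath n g).alphaSpectralRadius α ≤ G.alphaSpectralRadius α ∧
      1 < (Digraph.cycleWithPath n g).alphaSpectralRadius α ∧
      (G.alphaSpectralRadius α = (Digraph.cycleWithPath n g).alphaSpectralRadius α ↔
        G.IsIsomorphic (Digraph.cycleWithPath n g)) := by
  have hgn' : g + 1 ≤ n := by omega
  obtain ⟨t, ht, hroot⟩ := Digraph.exists_isCycleWithPathRoot hα0 hα1 hg hgn'
  have hC := Digraph.isCycleWithPathLevel_cycleWithPath hg hgn'
  have hCrad := hC.alphaSpectralRadius_eq (Fintype.card_fin n) hg hgn' hα0 hα1 ht hroot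
  obtain ⟨hle, heq⟩ := hconn.le_alphaSpectralRadius hcard hg hgn'
    (Digraph.hasDirectedCycle_of_girth_eq hgirth) hα0 hα1 ht hroot
  rw [hCrad]
  refine ⟨hle, by nlinarith, fun h => ?_, fun ⟨e⟩ => ?_⟩
  · obtain ⟨h, H⟩ := heq h
    exact H.isIsomorphic hcard hg hgn'
  -- The numbering of `C_{n,g}` is pulled back to `G`, so the same `t` gives its spectral radius.
  · exact (hC.comp e).alphaSpectralRadius_eq hcard hg hgn' hα0 hα1 ht hroot
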